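/- **Setting.** Fix a temperature $T>0$, a ratio $M>1$, couplings $\lambda_+,\lambda_m\in\mathbb C$, and $E=\mathbb R$ or $E=U(1)$. Write $\int dp_0=T\sum_{p_0\in\pi T(2\mathbb Z+1)}$ for integration over Matsubara frequencies, with $\delta(0)=1/T$ and $\delta(p_0)=0$ for $p_0\neq0$. Write $\int dp$ for $\int_{\mathbb R}dp$ if $E=\mathbb R$ and for $\sum_{p\in\mathbb Z}$ if $E=U(1)$. Let $e(\vec p)=p_1^2+p_2^2+p_3^2-1$, let $\varepsilon_{\sigma\sigma'}$ be antisymmetric with $\varepsilon_{12}=-1$, and for a scale $i\in\mathbb N$ and spins $\sigma,\sigma'\in\{1,2\}$ let $$C_{\sigma\sigma';i}(p_0,\vec p)=\int_{M^{-2i}}^{M^{-2(i-1)}}d\alpha\,\bigl(-ip_0\delta_{\sigma\sigma'}+\varepsilon_{\sigma\sigma'}e(\vec p)\bigr)e^{-\alpha(p_0^2+e(\vec p)^2)} .$$ The Fermionic fields $\chi_\sigma(p_0,p_1,p_2,p_3)$ have two kinds of quartic vertices, each conserving $p_0$. The tetrahedral one is, for $\sigma=1,2$, $$\lambda_+\,\chi_\sigma(p_1,p_2,p_3)\chi_\sigma(p_1,p_2',p_3')\chi_\sigma(p_1',p_2,p_3')\chi_\sigma(p_1',p_2',p_3).$$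 The melonic one of colour $1$ is $$\lambda_m\,\chi_1(p_1,p_2,p_3)\chi_2(p_1',p_2,p_3)\chi_1(p_1',p_2',p_3')\chi_2(p_1,p_2',p_3'),$$ and those of colours $2,3$ are obtained by permuting the colours. A Feynman graph $G$ is obtained from a finite set of such vertices by joining some pairs of fields by (oriented) propagator lines $\ell\in\mathcal L(G)$; the remaining fields are the amputated external legs. A face of colour $c\in\{1,2,3\}$ is a maximal alternating sequence of lines and of pairs of fields that share a momentum component of colour $c$ at a vertex. It is internal if it closes into a cycle and external otherwise, so each line lies on one face of each colour. Let $V(G)$ be the number of vertices and $F_{\rm int}(G)$ the number of internal faces, and put $$\omega_{\deg}(G)=-(V(G)-1)+\tfrac12F_{\rm int}(G).$$ Given a scale assignment $\mu=(i_\ell)_{\ell\in\mathcal L(G)}\in\{0,\dots,\rho\}^{\mathcal L(G)}$, the frequencies of the external legs and the momenta $p_f$ of the external faces, the amplitude is $$A_{G;\mu}=K_0\prod_v(-\lambda_v)\int\prod_{\ell}dp_{0;\ell}\prod_{f\ \rm internal}dp_f\;\prod_v\delta\Bigl(\sum_{l=1}^4p_{0;l;v}\Bigr)\prod_\ell C_{\sigma_\ell\sigma_\ell';i_\ell}(p_{0;\ell},\vec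 p_\ell).$$ Here $\vec p_\ell$ consists of the momenta of the three faces through $\ell$; $\sigma_\ell,\sigma'_\ell$ are the spins at the source and target of $\ell$; and $p_{0;l;v}$ is the frequency of the $l$-th field at $v$, equal to $p_{0;\ell}$ at the source of a line $\ell$, to $-p_{0;\ell}$ at its target, and to the given frequency at an external leg. The constant $K_0$ is the Fermionic sign of the contraction times $\prod_v|{\rm Sym}(v)|/|{\rm Aut}(G)|$, where ${\rm Sym}(v)$ is the group of colour- and spin-preserving permutations of the fields of $v$, and ${\rm Aut}(G)$ is the group of automorphisms of $G$ that fix all external legs. For $i\ge1$ let $G^i_{(k)}$, $k=1,2,\dots$, be the connected components of the subgraph of $G$ made of all lines with $i_\ell\ge i$ (the quasi-local subgraphs). **Theorem (Power counting).** There is a constant $K>0$, depending only on $T,M,\lambda_+,\lambda_m,E$, such that for every connected graph $G$, every $\rho\in\mathbb N$, every scale assignment $\mu\in\{0,\dots,\rho\}^{\mathcal L(G)}$ and all values of the external frequencies and of the external face momenta, the integral defining $A_{G;\mu}$ converges absolutely and $$|A_{G;\mu}|\le K^{V(G)}\prod_{i=1}^{\rho}\prod_k M^{\omega_{\deg}(G^i_{(k)})}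 .$$ -/

import Mathlib

open MeasureTheory

noncomputable section

/-! ## Sliced covariance of the jellium model -/

/-- The space `E` in which each of the three tensor coordinates lives: the real line or the
circle `U(1)`. -/
inductive TensorSpace
  | line
  | circle

/-- The measure `dp` on one component of the dual momentum: Lebesgue measure on `ℝ` if `E = ℝ`,
counting measure on `ℤ ⊆ ℝ` if `E = U(1)`. -/
def TensorSpace.momentumMeasure : TensorSpace → Measure ℝ
  | .line => volume
  | .circle => Measure.sum fun n : ℤ => Measure.dirac (n : ℝ)

/-- `p₀ = (2 n + 1) π T` is the `n`-th Fermionic Matsubara frequency; this is the odd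
integer `2 n + 1`. -/
def oddMode (n : ℤ) : ℤ := 2 * n + 1

/-- The kinetic energy `e(p) = p² - 1`, with `p² = p₁² + p₂² + p₃²`. -/
def kineticEnergy (p : Fin 3 → ℝ) : ℝ := (∑ c, p c ^ 2) - 1

/-- The antisymmetric tensor on the two spin values, with `ε₁₂ = -1`
(the spins `1, 2` are the elements `0, 1` of `Fin 2`). -/
def spinEpsilon (s s' : Fin 2) : ℝ :=
  if s = s' then 0 else if s = 0 then -1 else 1

/-- The slice of index `i` of the covariance: the part of its parametric representation
with `α ∈ [M^{-2i}, M^{-2(i-1)}]`. -/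
def sliceCovariance (M : ℝ) (i : ℕ) (s s' : Fin 2) (p₀ : ℝ) (p : Fin 3 → ℝ) : ℂ :=
  ∫ α in (M ^ (-2 * (i : ℤ)))..(M ^ (-2 * ((i : ℤ) - 1))),
    ((if s = s' then -Complex.I * (p₀ : ℂ) else 0)
        + ((spinEpsilon s s' * kineticEnergy p : ℝ) : ℂ))
      * ((Real.exp (-α * (p₀ ^ 2 + kineticEnergy p ^ 2)) : ℝ) : ℂ)

/-! ## The quartic interactions -/

/-- The quartic vertices: the tetrahedral one, all four fields having the same spin `s`, and the
melonic one of colour `c`. -/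
inductive Bubble
  | tetra (s : Fin 2)
  | melon (c : Fin 3)

namespace Bubble

/-- Slots `0, 1, 2, 3` are the four fields of the vertex, in the order of the monomial
`χ(p₁,p₂,p₃) χ(p₁,p₂',p₃') χ(p₁',p₂,p₃') χ(p₁',p₂',p₃)` for the tetrahedral vertex and
`χ₁(p₁,p₂,p₃) χ₂(p₁',p₂,p₃) χ₁(p₁',p₂',p₃') χ₂(p₁,p₂',p₃')` for the melonic vertex of the first
colour. `partner b c` exchanges the two slots that share a component of colour `c`. -/
def partner : Bubble → Fin 3 → Equiv.Perm (Fin 4)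
  | tetra _, c =>
      if c = 0 then Equiv.swap 0 1 * Equiv.swap 2 3
      else if c = 1 then Equiv.swap 0 2 * Equiv.swap 1 3
      else Equiv.swap 0 3 * Equiv.swap 1 2
  | melon c', c =>
      if c = c' then Equiv.swap 0 3 * Equiv.swap 1 2
      else Equiv.swap 0 1 * Equiv.swap 2 3

/-- The spins of the four fields. -/
def spin : Bubble → Fin 4 → Fin 2
  | tetra s, _ => s
  | melon _, a => ![0, 1, 0, 1] a

/-- The coupling constant of the vertex. -/
def coupling (lamPlus lamMelon : ℂ) : Bubble → ℂ
  | tetra _ => lamPlus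
  | melon _ => lamMelon

/-- Permutations of the four fields that preserve colours and spins. -/
def Symmetry (b : Bubble) : Type :=
  {s : Equiv.Perm (Fin 4) //
    (∀ c a, b.partner c (s a) = s (b.partner c a)) ∧ ∀ a, b.spin (s a) = b.spin a}

end Bubble

/-! ## Feynman graphs -/

/-- A Feynman graph with vertex set `V` and set of (internal) propagator lines `L`.
The half-edges are the pairs `(v, a)` of a vertex and one of its four fields. A line
joins two half-edges; it is given an (arbitrary) orientation. The half-edges through which no line
passes are the amputated external legs. -/
structure FeynmanGraph (V L : Type) where
  kind : V → Bubble
  src : L → V × Fin 4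
  tgt : L → V × Fin 4
  src_injective : Function.Injective src
  tgt_injective : Function.Injective tgt
  src_ne_tgt : ∀ l l', src l ≠ tgt l'

namespace FeynmanGraph

variable {V L : Type}

/-- The spin of the field at a half-edge. -/
def spinAt (G : FeynmanGraph V L) (h : V × Fin 4) : Fin 2 := (G.kind h.1).spin h.2

/-- The half-edge joined to `h` by the edge of colour `c` of the vertex of `h`. -/
def colorPartner (G : FeynmanGraph V L) (c : Fin 3) (h : V × Fin 4) : V × Fin 4 :=
  (h.1, (G.kind h.1).partner c h.2)

/-- `h` and `k` are the two ends of a propagator line (an edge of colour `0`). -/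
def Joined (G : FeynmanGraph V L) (h k : V × Fin 4) : Prop :=
  ∃ l, (G.src l = h ∧ G.tgt l = k) ∨ (G.src l = k ∧ G.tgt l = h)

/-- `h` is an external leg. -/
def IsExternal (G : FeynmanGraph V L) (h : V × Fin 4) : Prop :=
  ∀ l, G.src l ≠ h ∧ G.tgt l ≠ h

/-- The external legs. -/
abbrev ExternalLeg (G : FeynmanGraph V L) : Type := {h : V × Fin 4 // G.IsExternal h}

/-- The simple graph on the vertices that is generated by the lines in `S`. -/
def skeleton (G : FeynmanGraph V L) (S : Set L) : SimpleGraph V :=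
  SimpleGraph.fromRel fun v w => ∃ l ∈ S, (G.src l).1 = v ∧ (G.tgt l).1 = w

/-- The graph is connected through its propagator lines (in particular, it has a vertex). -/
def Connected (G : FeynmanGraph V L) : Prop := (G.skeleton Set.univ).Connected

/-! ### Faces -/

/-- Two half-edges are on the same face of colour `c` if they are connected by lines
and by edges of colour `c` of the vertices. -/
def faceSetoid (G : FeynmanGraph V L) (c : Fin 3) : Setoid (V × Fin 4) :=
  Relation.EqvGen.setoid fun h k => G.Joined h k ∨ k = G.colorPartner c h

/-- The faces: maximal alternating sequences of lines and of edges of one colour `c`. -/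
abbrev Face (G : FeynmanGraph V L) : Type := Σ c : Fin 3, Quotient (G.faceSetoid c)

/-- The face of colour `c` through the half-edge `h`. -/
def faceOf (G : FeynmanGraph V L) (c : Fin 3) (h : V × Fin 4) : G.Face :=
  ⟨c, Quotient.mk (G.faceSetoid c) h⟩

/-- A face is internal (closed) if it does not end at external legs. -/
def IsInternalFace (G : FeynmanGraph V L) (f : G.Face) : Prop :=
  ∀ h, G.faceOf f.1 h = f → ¬ G.IsExternal h

/-- The closed faces. -/
abbrev InternalFace (G : FeynmanGraph V L) : Type := {f : G.Face // G.IsInternalFace f}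

/-- The open faces. -/
abbrev ExternalFace (G : FeynmanGraph V L) : Type := {f : G.Face // ¬ G.IsInternalFace f}

instance [Finite V] (G : FeynmanGraph V L) : Fintype G.InternalFace := Fintype.ofFinite _

/-- The divergence degree `ω_deg(G) = -(V(G) - 1) + F_int(G) / 2`. -/
def divergenceDegree (G : FeynmanGraph V L) : ℝ :=
  -((Nat.card V : ℝ) - 1) + (1 / 2) * (Nat.card G.InternalFace : ℝ)

/-! ### Subgraphs -/

/-- The subgraph with vertex set `W` whose lines are the lines in `S` with both ends in `W`.
The half-edges of the lines that were removed become external legs. -/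
def subgraph (G : FeynmanGraph V L) (W : Set V) (S : Set L) :
    FeynmanGraph W {l : L // l ∈ S ∧ (G.src l).1 ∈ W ∧ (G.tgt l).1 ∈ W} where
  kind w := G.kind w
  src l := (⟨(G.src l).1, l.2.2.1⟩, (G.src l).2)
  tgt l := (⟨(G.tgt l).1, l.2.2.2⟩, (G.tgt l).2)
  src_injective := by
    intro l l' h
    simp only [Prod.mk.injEq, Subtype.mk.injEq] at h
    exact Subtype.ext (G.src_injective (Prod.ext h.1 h.2))
  tgt_injective := by
    intro l l' h
    simp only [Prod.mk.injEq, Subtype.mk.injEq] at h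
    exact Subtype.ext (G.tgt_injective (Prod.ext h.1 h.2))
  src_ne_tgt := by
    intro l l' h
    simp only [Prod.mk.injEq, Subtype.mk.injEq] at h
    exact G.src_ne_tgt l l' (Prod.ext h.1 h.2)

/-- The lines whose scale is at least `i`. -/
def highLines (μ : L → ℕ) (i : ℕ) : Set L := {l | i ≤ μ l}

/-- The index set of the connected components of the subgraph made of the lines of scale at
least `i`. (A vertex through which no such line passes is a component of
divergence degree `0`.) -/
abbrev Component (G : FeynmanGraph V L) (μ : L → ℕ) (i : ℕ) : Type :=
  (G.skeleton (highLines μ i)).ConnectedComponent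

/-- The quasi-local subgraph `G^i_(k)`: the `k`-th connected component of the subgraph made of the
lines of scale at least `i`. -/
def quasiLocal (G : FeynmanGraph V L) (μ : L → ℕ) (i : ℕ) (k : G.Component μ i) :=
  G.subgraph k.supp (highLines μ i)

/-! ### The combinatorial constant -/

/-- The automorphisms of the graph: permutations of the half-edges that preserve the vertices
with their type, colours and spins, that preserve the lines, and that fix every external leg.
(The half-edges of one vertex are connected by coloured edges, so they stay together.) -/
def Automorphism (G : FeynmanGraph V L) : Type :=
  {g : Equiv.Perm (V × Fin 4) //
    (∀ h, G.kind (g h).1 = G.kind h.1) ∧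
    (∀ c h, G.colorPartner c (g h) = g (G.colorPartner c h)) ∧
    (∀ h, G.spinAt (g h) = G.spinAt h) ∧
    (∀ h k, G.Joined h k → G.Joined (g h) (g k)) ∧
    ∀ h, G.IsExternal h → g h = h}

section Order

variable [LinearOrder V]

/-- The first end of a line, in the lexicographic order of the fields. -/
def lo (G : FeynmanGraph V L) (l : L) : V ×ₗ Fin 4 := min (toLex (G.src l)) (toLex (G.tgt l))

/-- The last end of a line, in the lexicographic order of the fields. -/
def hi (G : FeynmanGraph V L) (l : L) : V ×ₗ Fin 4 := max (toLex (G.src l)) (toLex (G.tgt l))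

/-- The sign of the Wick contraction: the signature of the permutation that rearranges the
fields (vertices in increasing order) into the contracted pairs (source first), followed by the
external fields. It is computed from the reversed lines, the crossings of two lines, and the
external fields below a line. -/
def wickSign (G : FeynmanGraph V L) : ℤ :=
  (-1) ^ (Set.ncard {l : L | toLex (G.tgt l) < toLex (G.src l)}
    + Set.ncard {x : L × L | G.lo x.1 < G.lo x.2 ∧ G.lo x.2 < G.hi x.1 ∧ G.hi x.1 < G.hi x.2}
    + Set.ncard {x : L × G.ExternalLeg |
        G.lo x.1 < toLex x.2.1 ∧ toLex x.2.1 < G.hi x.1})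

/-- The constant `K₀`: the Fermionic sign times `∏_v |Sym(v)| / |Aut G|`. The latter is the number
of the Wick contractions on labelled vertices that yield the graph `G`, divided by the
factor `n!` of the `n`-th order of the expansion of the exponential. -/
def combinatorialConstant [Fintype V] (G : FeynmanGraph V L) : ℂ :=
  (G.wickSign : ℂ) * (∏ v, (Nat.card (G.kind v).Symmetry : ℂ)) / (Nat.card G.Automorphism : ℂ)

end Order

/-! ### Amplitudes -/

open Classical in
/-- The frequency, in units of `π T`, of the field at a half-edge: the line `l` with Matsubara
index `n l` carries `2 (n l) + 1` at its source and the opposite at its target, and the field at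
an external leg `h` has the given index `w h`. -/
def halfEdgeMode [Fintype L] (G : FeynmanGraph V L) (w : G.ExternalLeg → ℤ) (n : L → ℤ)
    (h : V × Fin 4) : ℤ :=
  if hh : G.IsExternal h then oddMode (w ⟨h, hh⟩)
  else ∑ l, ((if G.src l = h then oddMode (n l) else 0)
    - (if G.tgt l = h then oddMode (n l) else 0))

open Classical in
/-- The momentum of each face: integrated on the closed faces, given on the open faces. -/
def faceMomentum (G : FeynmanGraph V L) (q : G.ExternalFace → ℝ) (p : G.InternalFace → ℝ)
    (f : G.Face) : ℝ :=
  if hf : G.IsInternalFace f then p ⟨f, hf⟩ else q ⟨f, hf⟩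

/-- The spatial momentum of a line: one component for each of the three faces through it. -/
def lineMomentum (G : FeynmanGraph V L) (q : G.ExternalFace → ℝ) (p : G.InternalFace → ℝ)
    (l : L) (c : Fin 3) : ℝ :=
  G.faceMomentum q p (G.faceOf c (G.src l))

variable [Fintype V] [Fintype L]

/-- The integrand of the amplitude at the scale assignment `μ`. The frequency integral is
`∫ dp₀ = T ∑_{p₀}`, whence a factor `T` for each line, and `δ(p₀)` is the delta function
for this measure, that is, `T⁻¹` at `0` and zero elsewhere. -/
def integrand (G : FeynmanGraph V L) (M T : ℝ) (μ : L → ℕ)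
    (w : G.ExternalLeg → ℤ) (q : G.ExternalFace → ℝ)
    (x : (L → ℤ) × (G.InternalFace → ℝ)) : ℂ :=
  (∏ v : V, if ∑ a : Fin 4, G.halfEdgeMode w x.1 (v, a) = 0 then ((T : ℂ))⁻¹ else 0)
    * ∏ l : L, ((T : ℂ) * sliceCovariance M (μ l) (G.spinAt (G.src l)) (G.spinAt (G.tgt l))
        (Real.pi * T * (oddMode (x.1 l) : ℝ)) (G.lineMomentum q x.2 l))

/-- Summation over the Matsubara indices of all lines and integration over the momenta of
all closed faces. -/
def loopMeasure (G : FeynmanGraph V L) (E : TensorSpace) :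
    Measure ((L → ℤ) × (G.InternalFace → ℝ)) :=
  Measure.count.prod (Measure.pi fun _ => E.momentumMeasure)

/-- The amputated amplitude `A_{G;μ}`, as a function of the frequencies `w` of the external legs and
of the momenta `q` of the open faces. -/
def amplitude [LinearOrder V] (G : FeynmanGraph V L) (E : TensorSpace) (M T : ℝ)
    (lamPlus lamMelon : ℂ) (μ : L → ℕ)
    (w : G.ExternalLeg → ℤ) (q : G.ExternalFace → ℝ) : ℂ :=
  G.combinatorialConstant * (∏ v, -(G.kind v).coupling lamPlus lamMelon)
    * ∫ x, G.integrand M T μ w q x ∂(G.loopMeasure E)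

end FeynmanGraph

end

noncomputable section

/-! ## The slices of the covariance -/

/-! A slice of scale `i` is bounded by a constant times `M^{-i}`, a Gaussian of width `M^i` in the
frequency, and Gaussians of width `M^{i/2}` in the momentum components (`norm_sliceCovariance_le`);
the latter arise because `e(p)² / (2 M^{2i})` dominates `p² / M^i` up to an additive constant. So a
line gains `M^{-i}`, a free frequency sum costs `M^i`, and a face integral costs `M^{i/2}`.

Each closed face is integrated with the decay of its line of lowest scale, the cheapest choice.
Frequency conservation is a linear system given by the incidence matrix, so the frequencies on a
spanning forest `B` are fixed by the others (`eq_of_conservation`). Off `B` the cost of the sum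
cancels the gain of the line. What remains is `M^{-i}` for each line of `B` and `M^{i/2}` for each
closed face, `i` being its lowest scale.

Now each exponent is written as a number of scales between `1` and its value. The forest is grown
greedily from the highest scale down (`exists_linearIndepOn_forall_scale`), so at every scale `i` it
contains at least `V` minus the number of components lines of scale at least `i`. A face whose
lowest scale is at least `i` is closed within a single component (`card_internalFace_le_sum`). Hence
the exponent at scale `i` is at most the sum of the divergence degrees of the quasi-local subgraphs.
There are at most `4V` lines and `12V` closed faces, so all constants fit into `K^V`. -/

lemma mul_exp_neg_sq_div_two_le_one (x : ℝ) : x * Real.exp (-(x ^ 2 / 2)) ≤ 1 := by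
  rw [Real.exp_neg, ← div_eq_mul_inv, div_le_one (Real.exp_pos _)]
  nlinarith [Real.add_one_le_exp (x ^ 2 / 2), sq_nonneg (x - 1)]

/-- Half of the Gaussian exponent at `α = s⁻²` absorbs the prefactor `R` at the price of `s`; the
other half survives as decay. -/
lemma mul_exp_neg_mul_sq_le {s α R : ℝ} (hs : 0 < s) (hα : (s ^ 2)⁻¹ ≤ α) (hR : 0 ≤ R) :
    R * Real.exp (-α * R ^ 2) ≤ s * Real.exp (-(R ^ 2 / (2 * s ^ 2))) := by
  have h1 := mul_exp_neg_sq_div_two_le_one (R / s)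
  have h2 : Real.exp (-α * R ^ 2) ≤ Real.exp (-((R / s) ^ 2 / 2)) * Real.exp (-(R ^ 2 / (2 * s ^ 2))) := by
    rw [← Real.exp_add]
    apply Real.exp_le_exp.2
    have h3 : (s ^ 2)⁻¹ * R ^ 2 ≤ α * R ^ 2 := by gcongr
    have h4 : (s ^ 2)⁻¹ * R ^ 2 = (R / s) ^ 2 / 2 + R ^ 2 / (2 * s ^ 2) := by field_simp; ring
    linarith
  calc R * Real.exp (-α * R ^ 2)
      ≤ R * (Real.exp (-((R / s) ^ 2 / 2)) * Real.exp (-(R ^ 2 / (2 * s ^ 2)))) := by gcongr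
    _ = s * ((R / s) * Real.exp (-((R / s) ^ 2 / 2))) * Real.exp (-(R ^ 2 / (2 * s ^ 2))) := by
        field_simp
    _ ≤ s * 1 * Real.exp (-(R ^ 2 / (2 * s ^ 2))) := by gcongr
    _ = _ := by ring

/-- The Gaussian decay of one slice in the energy implies decay in each momentum component. -/
lemma exp_neg_kineticEnergy_sq_le {s : ℝ} (hs : 1 ≤ s) (p : Fin 3 → ℝ) :
    Real.exp (-(kineticEnergy p ^ 2 / (2 * s ^ 2)))
      ≤ Real.exp (3 / 2) * ∏ c, Real.exp (-s⁻¹ * p c ^ 2) := by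
  rw [← Real.exp_sum, ← Real.exp_add, ← Finset.mul_sum]
  apply Real.exp_le_exp.2
  have h0 : 0 < s := by linarith
  have h1 : ∑ c, p c ^ 2 = kineticEnergy p + 1 := by simp [kineticEnergy]
  rw [h1]
  have h2 : kineticEnergy p ^ 2 / (2 * s ^ 2) = (s⁻¹ * kineticEnergy p) ^ 2 / 2 := by
    field_simp
  have h3 : s⁻¹ ≤ 1 := inv_le_one_of_one_le₀ hs
  rw [h2]
  -- With `x = e(p)/s`, `x²/2 ≥ x - 1/2`, and `x ≥ p²/s - 1` since `s ≥ 1`; this is the source of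
  -- `3/2`.
  nlinarith [sq_nonneg (s⁻¹ * kineticEnergy p - 1)]

lemma norm_spinMatrix_le (s s' : Fin 2) (p₀ e : ℝ) :
    ‖(if s = s' then -Complex.I * (p₀ : ℂ) else 0) + ((spinEpsilon s s' * e : ℝ) : ℂ)‖
      ≤ Real.sqrt (p₀ ^ 2 + e ^ 2) := by
  apply Real.le_sqrt_of_sq_le
  by_cases h : s = s'
  · simp [h, spinEpsilon]
    positivity
  · rw [if_neg h, spinEpsilon, if_neg h]
    split_ifs <;> simp <;> positivity

/-- The constant of the bound on the slices of the covariance. -/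
def sliceConst (M : ℝ) : ℝ := (M ^ 2 - 1) * Real.exp (3 / 2)

/-- With `s = M^i`, the integrand is of size `s` times the decay and the interval of `α` has length
`(M² - 1) s⁻²`, whence the net factor `s⁻¹`. -/
lemma norm_sliceCovariance_le {M : ℝ} (hM : 1 < M) (i : ℕ) (s s' : Fin 2) (p₀ : ℝ)
    (p : Fin 3 → ℝ) :
    ‖sliceCovariance M i s s' p₀ p‖ ≤ sliceConst M * ((M ^ i)⁻¹
      * Real.exp (-(p₀ ^ 2 / (2 * (M ^ i) ^ 2))) * ∏ c, Real.exp (-(M ^ i)⁻¹ * p c ^ 2)) := by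
  have hM0 : 0 < M := by linarith
  have hS1 : 1 ≤ M ^ i := one_le_pow₀ hM.le
  have ha : M ^ (-2 * (i : ℤ)) = ((M ^ i) ^ 2)⁻¹ := by
    rw [show -2 * (i : ℤ) = -((i * 2 : ℕ) : ℤ) by push_cast; ring, zpow_neg, zpow_natCast, pow_mul]
  have hb : M ^ (-2 * ((i : ℤ) - 1)) = M ^ 2 * ((M ^ i) ^ 2)⁻¹ := by
    rw [← ha, show -2 * ((i : ℤ) - 1) = 2 + -2 * (i : ℤ) by ring, zpow_add₀ hM0.ne']
    norm_cast
  rw [sliceCovariance, ha, hb]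
  generalize M ^ i = S at hS1 ⊢
  have hS0 : 0 < S := by linarith
  set R := Real.sqrt (p₀ ^ 2 + kineticEnergy p ^ 2) with hR
  have hR2 : p₀ ^ 2 + kineticEnergy p ^ 2 = R ^ 2 := (Real.sq_sqrt (by positivity)).symm
  have hab : (S ^ 2)⁻¹ ≤ M ^ 2 * (S ^ 2)⁻¹ :=
    le_mul_of_one_le_left (by positivity) (one_le_pow₀ hM.le)
  have key := intervalIntegral.norm_integral_le_of_norm_le_const
    (a := (S ^ 2)⁻¹) (b := M ^ 2 * (S ^ 2)⁻¹) (C := S * Real.exp (-(R ^ 2 / (2 * S ^ 2))))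
    (f := fun α => ((if s = s' then -Complex.I * (p₀ : ℂ) else 0)
        + ((spinEpsilon s s' * kineticEnergy p : ℝ) : ℂ))
      * ((Real.exp (-α * (p₀ ^ 2 + kineticEnergy p ^ 2)) : ℝ) : ℂ)) (by
      intro α hα
      rw [Set.uIoc_of_le hab] at hα
      rw [norm_mul, Complex.norm_real, Real.norm_of_nonneg (Real.exp_pos _).le, hR2]
      refine le_trans ?_ (mul_exp_neg_mul_sq_le hS0 hα.1.le (Real.sqrt_nonneg _))
      gcongr
      exact norm_spinMatrix_le _ _ _ _)
  refine key.trans ?_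
  have h5 := exp_neg_kineticEnergy_sq_le hS1 p
  have h6 : Real.exp (-(R ^ 2 / (2 * S ^ 2))) = Real.exp (-(p₀ ^ 2 / (2 * S ^ 2)))
      * Real.exp (-(kineticEnergy p ^ 2 / (2 * S ^ 2))) := by
    rw [← Real.exp_add, ← hR2]; ring_nf
  rw [abs_of_nonneg (by linarith), h6]
  have hM2 : 0 ≤ M ^ 2 - 1 := by nlinarith
  calc S * (Real.exp (-(p₀ ^ 2 / (2 * S ^ 2))) * Real.exp (-(kineticEnergy p ^ 2 / (2 * S ^ 2))))
        * (M ^ 2 * (S ^ 2)⁻¹ - (S ^ 2)⁻¹)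
      ≤ S * (Real.exp (-(p₀ ^ 2 / (2 * S ^ 2)))
        * (Real.exp (3 / 2) * ∏ c, Real.exp (-S⁻¹ * p c ^ 2)))
        * (M ^ 2 * (S ^ 2)⁻¹ - (S ^ 2)⁻¹) := by
        have : 0 ≤ M ^ 2 * (S ^ 2)⁻¹ - (S ^ 2)⁻¹ := by linarith
        gcongr
    _ = _ := by
        rw [sliceConst]
        field_simp

lemma sliceConst_nonneg {M : ℝ} (hM : 1 < M) : 0 ≤ sliceConst M := by
  have : 0 ≤ M ^ 2 - 1 := by nlinarith
  rw [sliceConst]; positivity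

lemma continuous_sliceCovariance (M : ℝ) (i : ℕ) (s s' : Fin 2) (p₀ : ℝ) :
    Continuous (sliceCovariance M i s s' p₀) := by
  unfold sliceCovariance
  apply intervalIntegral.continuous_parametric_intervalIntegral_of_continuous'
  unfold kineticEnergy
  fun_prop

/-! ## Gaussian sums and integrals -/

lemma summable_exp_neg_mul_int_sq {a : ℝ} (ha : 0 < a) :
    Summable fun n : ℤ => Real.exp (-a * (n : ℝ) ^ 2) := by
  refine (summable_pow_mul_jacobiTheta₂_term_bound 0 (T := a / Real.pi) (by positivity) 0).congr
    fun n => ?_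
  have := Real.pi_pos
  simp only [pow_zero, one_mul, mul_zero, zero_mul, sub_zero]
  congr 1
  field_simp

/-- Poisson summation turns the rate `a` into `π²/a`, with prefactor `√(π/a)`. For `a ≤ 1` the new
rate is at least `1`, so the dual sum is bounded by the one of rate `1`. -/
lemma exists_tsum_exp_neg_mul_int_sq_le :
    ∃ C : ℝ, 0 < C ∧ ∀ a : ℝ, 0 < a → a ≤ 1 →
      ∑' n : ℤ, Real.exp (-a * (n : ℝ) ^ 2) ≤ C / Real.sqrt a := by
  have hpi := Real.pi_pos
  refine ⟨Real.sqrt Real.pi * ∑' n : ℤ, Real.exp (-1 * (n : ℝ) ^ 2), ?_, fun a ha ha1 => ?_⟩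
  · have := (summable_exp_neg_mul_int_sq one_pos).tsum_pos (fun n => (Real.exp_pos _).le) 0
      (Real.exp_pos _)
    positivity
  · have h := Real.tsum_exp_neg_mul_int_sq (a := a / Real.pi) (by positivity)
    have h1 : ∀ n : ℤ, -Real.pi * (a / Real.pi) * (n : ℝ) ^ 2 = -a * (n : ℝ) ^ 2 := by
      intro n; field_simp
    simp only [h1] at h
    rw [h, ← Real.sqrt_eq_rpow, one_div, ← Real.sqrt_inv, inv_div, Real.sqrt_div hpi.le,
      mul_div_right_comm]
    gcongr with n
    · exact summable_exp_neg_mul_int_sq one_pos |>.of_nonneg_of_le (fun n => (Real.exp_pos _).le)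
        fun n => by
          apply Real.exp_le_exp.2
          have : 1 ≤ Real.pi / (a / Real.pi) := by
            rw [le_div_iff₀ (by positivity), one_mul, div_le_iff₀ hpi]
            nlinarith [Real.pi_gt_three]
          have := sq_nonneg (n : ℝ)
          rw [neg_div]
          nlinarith
    · exact summable_exp_neg_mul_int_sq one_pos
    · have : 1 ≤ Real.pi / (a / Real.pi) := by
        rw [le_div_iff₀ (by positivity), one_mul, div_le_iff₀ hpi]
        nlinarith [Real.pi_gt_three]
      rw [neg_div]
      linarith

/-- Needed for Tonelli. For the circle, the measure is the image of the counting measure under the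
closed embedding of `ℤ` in `ℝ`. -/
instance TensorSpace.sigmaFinite_momentumMeasure (E : TensorSpace) :
    SigmaFinite E.momentumMeasure := by
  cases E
  · exact inferInstanceAs (SigmaFinite (volume : Measure ℝ))
  · have h : MeasurableEmbedding (fun n : ℤ => (n : ℝ)) :=
      Int.isClosedEmbedding_coe_real.measurableEmbedding
    have : TensorSpace.circle.momentumMeasure = Measure.count.map (fun n : ℤ => (n : ℝ)) := by
      rw [TensorSpace.momentumMeasure, Measure.count, Measure.map_sum h.measurable.aemeasurable]
      simp [Measure.map_dirac]
    rw [this]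
    exact h.sigmaFinite_map

/-- The Gaussian bound on the momentum integrals of both tensor spaces. -/
lemma exists_integral_momentumMeasure_le (E : TensorSpace) :
    ∃ C : ℝ, 0 < C ∧ ∀ a : ℝ, 0 < a → a ≤ 1 →
      Integrable (fun p : ℝ => Real.exp (-a * p ^ 2)) E.momentumMeasure ∧
      ∫ p, Real.exp (-a * p ^ 2) ∂E.momentumMeasure ≤ C / Real.sqrt a := by
  cases E
  · refine ⟨Real.sqrt Real.pi, Real.sqrt_pos.2 Real.pi_pos, fun a ha _ =>
      ⟨integrable_exp_neg_mul_sq ha, ?_⟩⟩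
    rw [TensorSpace.momentumMeasure, integral_gaussian, Real.sqrt_div Real.pi_pos.le]
  · obtain ⟨C, hC, h⟩ := exists_tsum_exp_neg_mul_int_sq_le
    refine ⟨C, hC, fun a ha ha1 => ?_⟩
    have hm : Integrable (fun p : ℝ => Real.exp (-a * p ^ 2))
        TensorSpace.circle.momentumMeasure := by
      refine ⟨by fun_prop, ?_⟩
      rw [hasFiniteIntegral_iff_ofReal (ae_of_all _ fun _ => (Real.exp_pos _).le),
        TensorSpace.momentumMeasure, lintegral_sum_measure]
      simp only [lintegral_dirac]
      rw [← ENNReal.ofReal_tsum_of_nonneg (fun _ => (Real.exp_pos _).le)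
        (summable_exp_neg_mul_int_sq ha)]
      exact ENNReal.ofReal_lt_top
    refine ⟨hm, ?_⟩
    rw [TensorSpace.momentumMeasure] at hm ⊢
    rw [integral_sum_measure hm]
    simpa only [integral_dirac] using h a ha ha1

/-- The bound on the sum over the Matsubara frequencies of a line of scale `s`. -/
lemma exists_tsum_matsubara_le {T : ℝ} (hT : 0 < T) :
    ∃ C : ℝ, 0 < C ∧ ∀ s : ℝ, 1 ≤ s →
      Summable (fun n : ℤ =>
        Real.exp (-((Real.pi * T * (oddMode n : ℝ)) ^ 2 / (2 * s ^ 2)))) ∧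
      ∑' n : ℤ, Real.exp (-((Real.pi * T * (oddMode n : ℝ)) ^ 2 / (2 * s ^ 2))) ≤ C * s := by
  obtain ⟨C, hC, h⟩ := exists_tsum_exp_neg_mul_int_sq_le
  have hpi := Real.pi_pos
  -- The minimum with `1` keeps the rate `b / s²` in the range `(0, 1]` of the theta bound.
  set b := min 1 ((Real.pi * T) ^ 2 / 2) with hb
  have hb0 : 0 < b := by positivity
  refine ⟨C / Real.sqrt b, by positivity, fun s hs => ?_⟩
  have hs0 : 0 < s := by linarith
  have ha0 : 0 < b / s ^ 2 := by positivity
  have ha1 : b / s ^ 2 ≤ 1 := by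
    rw [div_le_one (by positivity)]
    exact (min_le_left _ _).trans (one_le_pow₀ hs)
  have hinj : Function.Injective oddMode := fun m n h => by unfold oddMode at h; omega
  have hle : ∀ n : ℤ, Real.exp (-((Real.pi * T * (oddMode n : ℝ)) ^ 2 / (2 * s ^ 2)))
      ≤ Real.exp (-(b / s ^ 2) * (oddMode n : ℝ) ^ 2) := by
    intro n
    apply Real.exp_le_exp.2
    rw [neg_mul, neg_le_neg_iff]
    calc b / s ^ 2 * (oddMode n : ℝ) ^ 2 ≤ ((Real.pi * T) ^ 2 / 2) / s ^ 2 * (oddMode n : ℝ) ^ 2 := by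
          gcongr; exact min_le_right _ _
      _ = _ := by field_simp
  have hS := summable_exp_neg_mul_int_sq ha0
  have hS' : Summable fun n : ℤ => Real.exp (-(b / s ^ 2) * (oddMode n : ℝ) ^ 2) :=
    hS.comp_injective hinj
  have hS'' := hS'.of_nonneg_of_le (fun _ => (Real.exp_pos _).le) hle
  refine ⟨hS'', ?_⟩
  calc _ ≤ ∑' n : ℤ, Real.exp (-(b / s ^ 2) * (oddMode n : ℝ) ^ 2) := hS''.tsum_le_tsum hle hS'
    _ ≤ ∑' n : ℤ, Real.exp (-(b / s ^ 2) * (n : ℝ) ^ 2) :=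
      tsum_comp_le_tsum_of_inj hS (fun _ => (Real.exp_pos _).le) hinj
    _ ≤ C / Real.sqrt (b / s ^ 2) := h _ ha0 ha1
    _ = C / Real.sqrt b * s := by
      rw [Real.sqrt_div hb0.le, Real.sqrt_sq hs0.le]; field_simp

/-! ## Sums and integrals of products -/

lemma lintegral_pi_prod_ofReal {ι α : Type*} [Fintype ι] [MeasurableSpace α] {μ : Measure α}
    [SigmaFinite μ] {f : ι → α → ℝ} (hf : ∀ i, Integrable (f i) μ) (h0 : ∀ i x, 0 ≤ f i x) :
    ∫⁻ x, ENNReal.ofReal (∏ i, f i (x i)) ∂(Measure.pi fun _ : ι => μ)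
      = ENNReal.ofReal (∏ i, ∫ x, f i x ∂μ) := by
  rw [← ofReal_integral_eq_lintegral_ofReal (Integrable.fintype_prod hf)
    (ae_of_all _ fun x => Finset.prod_nonneg fun i _ => h0 i _)]
  rw [integral_fintype_prod_eq_prod (μ := fun _ : ι => μ)]

lemma pi_count_eq_count {ι α : Type*} [Fintype ι] [Countable α] [MeasurableSpace α]
    [MeasurableSingletonClass α] :
    Measure.pi (fun _ : ι => (Measure.count : Measure α)) = Measure.count := by
  refine Measure.ext_of_singleton fun x => ?_
  rw [Measure.pi_singleton]
  simp

/-- The counting case of the preceding product formula: a finite product of counting measures on `ℤ`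
is the counting measure. -/
lemma tsum_pi_prod_ofReal {ι : Type*} [Fintype ι] {f : ι → ℤ → ℝ} (hf : ∀ i, Summable (f i))
    (h0 : ∀ i x, 0 ≤ f i x) :
    ∑' x : ι → ℤ, ENNReal.ofReal (∏ i, f i (x i)) = ENNReal.ofReal (∏ i, ∑' x, f i x) := by
  have hi : ∀ i, Integrable (f i) Measure.count := fun i => by
    refine ⟨(measurable_of_countable _).aestronglyMeasurable, ?_⟩
    rw [hasFiniteIntegral_iff_ofReal (ae_of_all _ (h0 i)), lintegral_count,
      ← ENNReal.ofReal_tsum_of_nonneg (h0 i) (hf i)]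
    exact ENNReal.ofReal_lt_top
  have h := lintegral_pi_prod_ofReal (μ := (Measure.count : Measure ℤ)) hi h0
  rw [pi_count_eq_count, lintegral_count] at h
  simpa only [integral_countable (hi _), Measure.real, Measure.count_singleton, ENNReal.toReal_one,
    one_smul] using h

/-! ## Greedy bases -/

/-- A basis adapted to the filtration by the scales: for each `i` its vectors of scale at least `i`
span all the vectors of scale at least `i`. -/
lemma exists_linearIndepOn_forall_scale {K ι W : Type*} [DivisionRing K] [AddCommGroup W]
    [Module K W] (v : ι → W) (μ : ι → ℕ) {ρ : ℕ} (hμ : ∀ l, μ l ≤ ρ) :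
    ∃ B : Set ι, LinearIndepOn K v B ∧
      ∀ i, v '' {l | i ≤ μ l} ⊆ Submodule.span K (v '' (B ∩ {l | i ≤ μ l})) := by
  -- Induction on the number `k` of top scales already treated; `ρ < i + k` says that `i` is one of
  -- them or lies above `ρ`.
  suffices h : ∀ k : ℕ, ∃ B : Set ι, B ⊆ {l | ρ < μ l + k} ∧ LinearIndepOn K v B ∧
      ∀ i, ρ < i + k → v '' {l | i ≤ μ l} ⊆ Submodule.span K (v '' (B ∩ {l | i ≤ μ l})) by
    obtain ⟨B, -, hB, h⟩ := h (ρ + 1)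
    exact ⟨B, hB, fun i => h i (by omega)⟩
  intro k
  induction k with
  | zero =>
    refine ⟨∅, Set.empty_subset _, linearIndepOn_empty _ _, fun i hi => ?_⟩
    rintro _ ⟨l, hl, rfl⟩
    have := hμ l
    simp only [Set.mem_ofPred_eq] at hl
    omega
  | succ k ih =>
    obtain ⟨B, hBt, hB, hs⟩ := ih
    obtain ⟨b, hbt, hBb, hspan, hb⟩ := exists_linearIndepOn_extension (t := {l | ρ < μ l + (k + 1)})
      hB (fun l hl => by have := hBt hl; simp only [Set.mem_ofPred_eq] at this ⊢; omega)
    refine ⟨b, hbt, hb, fun i hi => ?_⟩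
    by_cases hik : ρ < i + k
    · exact (hs i hik).trans (Submodule.span_mono
        (Set.image_mono (Set.inter_subset_inter_left _ hBb)))
    -- Here `i + k = ρ`: the newly added scale, which the extended basis spans by construction.
    · have : {l | i ≤ μ l} = {l | ρ < μ l + (k + 1)} := by
        ext l; simp only [Set.mem_ofPred_eq]; omega
      rw [this, Set.inter_eq_left.2 hbt]
      exact hspan

/-! ### Elementary estimates of products and sums -/

lemma prod_le_pow_card_of_nonneg {ι : Type*} [Fintype ι] {f : ι → ℝ} {C : ℝ} (h0 : ∀ i, 0 ≤ f i)
    (h : ∀ i, f i ≤ C) : ∏ i, f i ≤ C ^ Fintype.card ι := by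
  rw [← Finset.card_univ, ← Finset.prod_const]
  exact Finset.prod_le_prod (fun i _ => h0 i) fun i _ => h i

/-- Layer-cake formula: `μ l` counts the scales `1 ≤ i ≤ μ l`. It turns products over lines or faces
into products over scales. -/
lemma sum_eq_sum_card_filter_le {ι : Type*} (s : Finset ι) (μ : ι → ℕ) {ρ : ℕ}
    (hμ : ∀ l, μ l ≤ ρ) :
    ∑ l ∈ s, μ l = ∑ i ∈ Finset.Icc 1 ρ, (s.filter fun l => i ≤ μ l).card := by
  simp only [Finset.card_filter]
  rw [Finset.sum_comm]
  refine Finset.sum_congr rfl fun l _ => ?_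
  rw [← Finset.card_filter]
  have : (Finset.Icc 1 ρ).filter (fun i => i ≤ μ l) = Finset.Icc 1 (μ l) := by
    ext i
    have := hμ l
    simp only [Finset.mem_filter, Finset.mem_Icc]
    omega
  rw [this, Nat.card_Icc, Nat.add_sub_cancel]

namespace FeynmanGraph

variable {V L : Type} (G : FeynmanGraph V L)

/-! ## Frequency conservation -/

/-- The column of a line in the incidence matrix. -/
def lineVector (l : L) : V →₀ ℚ := Finsupp.single (G.src l).1 1 - Finsupp.single (G.tgt l).1 1

/-- The difference telescopes along a path, each step being a column up to sign. -/
lemma single_sub_single_mem_span {S : Set L} {v w : V} (h : (G.skeleton S).Reachable v w) :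
    (Finsupp.single v 1 - Finsupp.single w 1 : V →₀ ℚ)
      ∈ Submodule.span ℚ (G.lineVector '' S) := by
  obtain ⟨p⟩ := h
  induction p with
  | nil => simp
  | @cons u v w huv p ih =>
    have : (Finsupp.single u 1 - Finsupp.single v 1 : V →₀ ℚ)
        ∈ Submodule.span ℚ (G.lineVector '' S) := by
      rw [skeleton, SimpleGraph.fromRel_adj] at huv
      obtain ⟨-, ⟨l, hl, rfl, rfl⟩ | ⟨l, hl, rfl, rfl⟩⟩ := huv
      · exact Submodule.subset_span ⟨l, hl, rfl⟩
      · rw [← neg_sub]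
        exact Submodule.neg_mem _ (Submodule.subset_span ⟨l, hl, rfl⟩)
    have h := Submodule.add_mem _ this ih
    rwa [sub_add_sub_cancel] at h

/-- The rank of the incidence matrix is at least the number of vertices minus the number of
components. -/
lemma card_le_ncard_add_card_component [Finite V] [Finite L] {S B : Set L}
    (h : G.lineVector '' S ⊆ Submodule.span ℚ (G.lineVector '' B)) :
    Nat.card V ≤ B.ncard + Nat.card (G.skeleton S).ConnectedComponent := by
  classical
  have := Fintype.ofFinite V
  have := Fintype.ofFinite L
  -- One base vertex per component: modulo the columns of `B`, every vertex is equivalent to the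
  -- base vertex of its component, so the two families together span.
  let r : (G.skeleton S).ConnectedComponent → (V →₀ ℚ) := fun c => Finsupp.single c.out 1
  let X : Set (V →₀ ℚ) := G.lineVector '' B ∪ Set.range r
  have hX : X.Finite := (Set.toFinite B).image _ |>.union (Set.finite_range r)
  have := hX.fintype
  have htop : (⊤ : Submodule ℚ (V →₀ ℚ)) ≤ Submodule.span ℚ X := by
    rintro f -
    induction f using Finsupp.induction_linear with
    | zero => exact Submodule.zero_mem _
    | add f g hf hg => exact Submodule.add_mem _ hf hg
    | single v a =>
      have h1 : (G.skeleton S).Reachable v ((G.skeleton S).connectedComponentMk v).out :=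
        SimpleGraph.ConnectedComponent.exact
          (Quot.out_eq _).symm
      have h2 := Submodule.span_mono (R := ℚ) (Set.subset_union_left (t := Set.range r))
        (Submodule.span_le.2 h (G.single_sub_single_mem_span h1))
      have h3 : r ((G.skeleton S).connectedComponentMk v) ∈ Submodule.span ℚ X :=
        Submodule.subset_span (Or.inr ⟨_, rfl⟩)
      have h4 := Submodule.smul_mem _ a (Submodule.add_mem _ h2 h3)
      rw [show r ((G.skeleton S).connectedComponentMk v) = Finsupp.single _ 1 from rfl,
        sub_add_cancel] at h4
      rw [Finsupp.smul_single, smul_eq_mul, mul_one] at h4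
      exact h4
  have h1 : Module.finrank ℚ (Submodule.span ℚ X) = Nat.card V := by
    rw [top_le_iff.1 htop, finrank_top, Module.finrank_finsupp_self, Nat.card_eq_fintype_card]
  rw [← h1]
  calc _ ≤ X.toFinset.card := finrank_span_le_card X
    _ = X.ncard := (Set.ncard_eq_toFinset_card' X).symm
    _ ≤ (G.lineVector '' B).ncard + (Set.range r).ncard := Set.ncard_union_le _ _
    _ ≤ _ := by
      gcongr
      · exact Set.ncard_image_le (Set.toFinite B)
      · rw [← Set.image_univ]
        exact (Set.ncard_image_le Set.finite_univ).trans_eq (Set.ncard_univ _)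

section Frequencies

variable [Fintype L]

open Classical in
-- External frequencies and the odd offsets cancel in the difference, which makes the conservation
-- law homogeneous.
lemma halfEdgeMode_sub (w : G.ExternalLeg → ℤ) (n n' : L → ℤ) (h : V × Fin 4) :
    G.halfEdgeMode w n h - G.halfEdgeMode w n' h
      = 2 * ∑ l, (n l - n' l) * ((if G.src l = h then 1 else 0) - if G.tgt l = h then 1 else 0) := by
  unfold halfEdgeMode
  split_ifs with hh
  · simp [(hh _).1, (hh _).2]
  · rw [← Finset.sum_sub_distrib, Finset.mul_sum]
    refine Finset.sum_congr rfl fun l _ => ?_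
    unfold oddMode
    split_ifs <;> ring

/-- Summing over the four fields of a vertex gives a row of the incidence matrix, so the difference
of two solutions lies in its kernel. -/
lemma sum_smul_lineVector_eq_zero {w : G.ExternalLeg → ℤ} {n n' : L → ℤ}
    (hn : ∀ v, ∑ a : Fin 4, G.halfEdgeMode w n (v, a) = 0)
    (hn' : ∀ v, ∑ a : Fin 4, G.halfEdgeMode w n' (v, a) = 0) :
    ∑ l, ((n l - n' l : ℤ) : ℚ) • G.lineVector l = 0 := by
  classical
  ext v
  have h1 : ∑ a : Fin 4, (G.halfEdgeMode w n (v, a) - G.halfEdgeMode w n' (v, a)) = 0 := by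
    rw [Finset.sum_sub_distrib, hn, hn', sub_zero]
  have h3 : ∀ x : V × Fin 4, ∑ a : Fin 4, (if x = (v, a) then (1 : ℤ) else 0)
      = if x.1 = v then 1 else 0 := by
    rintro ⟨x, b⟩
    by_cases hx : x = v <;> simp [hx]
  simp only [halfEdgeMode_sub] at h1
  rw [← Finset.mul_sum, Finset.sum_comm] at h1
  simp only [← Finset.mul_sum, Finset.sum_sub_distrib, h3] at h1
  have h2 := (mul_eq_zero.1 h1).resolve_left two_ne_zero
  rw [Finsupp.finsetSum_apply]
  have h4 : ∀ l, (((n l - n' l : ℤ) : ℚ) • G.lineVector l) v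
      = ((((n l - n' l) * ((if (G.src l).1 = v then 1 else 0)
        - if (G.tgt l).1 = v then 1 else 0)) : ℤ) : ℚ) := by
    intro l
    simp only [lineVector, Finsupp.smul_apply, Finsupp.sub_apply, Finsupp.single_apply]
    push_cast
    rfl
  simp only [h4]
  rw [← Int.cast_sum, h2]
  simp

/-- The frequencies of the lines of a spanning forest are determined by the other ones. -/
lemma eq_of_conservation {B : Set L} (hB : LinearIndepOn ℚ G.lineVector B)
    {w : G.ExternalLeg → ℤ} {n n' : L → ℤ}
    (hn : ∀ v, ∑ a : Fin 4, G.halfEdgeMode w n (v, a) = 0)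
    (hn' : ∀ v, ∑ a : Fin 4, G.halfEdgeMode w n' (v, a) = 0)
    (h : ∀ l ∉ B, n l = n' l) : n = n' := by
  classical
  have h0 := G.sum_smul_lineVector_eq_zero hn hn'
  rw [← Finset.sum_subset (Finset.subset_univ B.toFinset)
    (fun l _ hl => by rw [h l (by simpa using hl)]; simp)] at h0
  have h1 := linearIndepOn_iff''.1 hB B.toFinset (fun l => ((n l - n' l : ℤ) : ℚ)) (by simp)
    (fun l hl => by rw [h l (by simpa using hl)]; simp) h0
  ext l
  by_cases hl : l ∈ B
  · have := h1 l (by simpa using hl)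
    exact sub_eq_zero.1 (by exact_mod_cast this)
  · exact h l hl

end Frequencies

/-! ## Faces of subgraphs -/

lemma faceOf_eq_iff {c : Fin 3} {h k : V × Fin 4} :
    G.faceOf c h = G.faceOf c k ↔ G.faceSetoid c h k := by
  unfold faceOf
  rw [Sigma.mk.injEq]
  simp [Quotient.eq]

lemma faceOf_tgt (c : Fin 3) (l : L) : G.faceOf c (G.tgt l) = G.faceOf c (G.src l) :=
  G.faceOf_eq_iff.2 (Relation.EqvGen.rel _ _ (Or.inl ⟨l, Or.inr ⟨rfl, rfl⟩⟩))

lemma exists_faceOf_eq (f : G.Face) : ∃ h, G.faceOf f.1 h = f := by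
  obtain ⟨c, q⟩ := f
  obtain ⟨h, rfl⟩ := Quotient.exists_rep q
  exact ⟨h, rfl⟩

lemma exists_line_of_not_isExternal {h : V × Fin 4} (hh : ¬ G.IsExternal h) :
    ∃ l, G.src l = h ∨ G.tgt l = h := by
  unfold IsExternal at hh
  push Not at hh
  obtain ⟨l, hl⟩ := hh
  exact ⟨l, or_iff_not_imp_left.2 hl⟩

/-- Each closed face passes through a line of lowest scale. -/
lemma exists_lowest_line (μ : L → ℕ) (f : G.InternalFace) :
    ∃ l, G.faceOf f.1.1 (G.src l) = f.1 ∧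
      ∀ l', G.faceOf f.1.1 (G.src l') = f.1 → μ l ≤ μ l' := by
  obtain ⟨h, hh⟩ := G.exists_faceOf_eq f.1
  obtain ⟨l, hl⟩ := G.exists_line_of_not_isExternal (f.2 h hh)
  have hl' : G.faceOf f.1.1 (G.src l) = f.1 := by
    rcases hl with hl | hl
    · rw [hl, hh]
    · rw [← faceOf_tgt, hl, hh]
  obtain ⟨m, hm, hmin⟩ := exists_minimalFor_of_wellFoundedLT
    (fun l => G.faceOf f.1.1 (G.src l) = f.1) μ ⟨l, hl'⟩
  exact ⟨m, hm, fun l' h' => (le_total (μ m) (μ l')).elim id (hmin h')⟩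

section Subgraph

variable (W : Set V) (S : Set L)

/-- The inclusion of the half-edges of a subgraph. -/
def inclusion (h : W × Fin 4) : V × Fin 4 := (h.1, h.2)

lemma faceSetoid_inclusion {c : Fin 3} {h k : W × Fin 4} (hk : (G.subgraph W S).faceSetoid c h k) :
    G.faceSetoid c (inclusion W h) (inclusion W k) := by
  induction (show Relation.EqvGen _ h k from hk) with
  | rel x y hxy =>
    refine Relation.EqvGen.rel _ _ ?_
    rcases hxy with ⟨l, ⟨rfl, rfl⟩ | ⟨rfl, rfl⟩⟩ | rfl
    · exact Or.inl ⟨l, Or.inl ⟨rfl, rfl⟩⟩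
    · exact Or.inl ⟨l, Or.inr ⟨rfl, rfl⟩⟩
    · exact Or.inr rfl
  | refl x => exact Relation.EqvGen.refl _
  | symm x y h ih => exact Relation.EqvGen.symm _ _ (ih h)
  | trans x y z h h' ih ih' => exact Relation.EqvGen.trans _ _ _ (ih h) (ih' h')

/-- The face of the graph that contains a face of a subgraph. -/
def faceMap (f : (G.subgraph W S).Face) : G.Face :=
  ⟨f.1, Quotient.map' (s₁ := (G.subgraph W S).faceSetoid f.1) (s₂ := G.faceSetoid f.1)
    (inclusion W) (fun _ _ h => G.faceSetoid_inclusion W S h) f.2⟩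

end Subgraph

/-- A closed face all of whose lines have scale at least `i` is a closed face of one of the
quasi-local subgraphs of scale `i`. -/
lemma exists_quasiLocal_internalFace (μ : L → ℕ) (i : ℕ) (f : G.InternalFace)
    (hf : ∀ l, G.faceOf f.1.1 (G.src l) = f.1 → i ≤ μ l) :
    ∃ (k : G.Component μ i) (g : (G.quasiLocal μ i k).InternalFace),
      G.faceMap k.supp (highLines μ i) g.1 = f.1 := by
  obtain ⟨⟨c, q⟩, hq⟩ := f
  obtain ⟨h, hh⟩ := Quotient.exists_rep q
  subst hh
  change ∀ l, G.faceOf c (G.src l) = G.faceOf c h → i ≤ μ l at hf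
  let k : G.Component μ i := (G.skeleton (highLines μ i)).connectedComponentMk h.1
  let h' : k.supp × Fin 4 := (⟨h.1, rfl⟩, h.2)
  refine ⟨k, ⟨(G.quasiLocal μ i k).faceOf c h', ?_⟩, rfl⟩
  -- If `x` were external in the component, the line through it in `G` would lie on the face, hence
  -- have scale at least `i` and both ends in `k`, and so belong to the component.
  rintro x (hx : (G.quasiLocal μ i k).faceOf c x = (G.quasiLocal μ i k).faceOf c h') hext
  have hx' : G.faceOf c (inclusion k.supp x) = G.faceOf c h :=
    congrArg (G.faceMap k.supp (highLines μ i)) hx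
  obtain ⟨l, hl⟩ := G.exists_line_of_not_isExternal (hq _ hx')
  have hli : i ≤ μ l := by
    apply hf
    rcases hl with hl | hl
    · rw [hl, hx']
    · rw [← faceOf_tgt, hl, hx']
  have hmk : (G.skeleton (highLines μ i)).connectedComponentMk (G.src l).1
      = (G.skeleton (highLines μ i)).connectedComponentMk (G.tgt l).1 := by
    -- A line with both ends at one vertex is no edge of the simple graph `skeleton`, so it is
    -- treated apart.
    by_cases he : (G.src l).1 = (G.tgt l).1
    · rw [he]
    · refine SimpleGraph.ConnectedComponent.sound (SimpleGraph.Adj.reachable ?_)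
      rw [skeleton, SimpleGraph.fromRel_adj]
      exact ⟨he, Or.inl ⟨l, hli, rfl, rfl⟩⟩
  have hxk : (G.skeleton (highLines μ i)).connectedComponentMk x.1.1 = k := x.1.2
  rcases hl with hl | hl
  · have h1 : (G.src l).1 = x.1 := congrArg Prod.fst hl
    have h2 : (G.src l).2 = x.2 := congrArg Prod.snd hl
    refine (hext ⟨l, hli, ?_, ?_⟩).1 (Prod.ext (Subtype.ext h1) h2)
    · rw [SimpleGraph.ConnectedComponent.mem_supp_iff, h1, hxk]
    · rw [SimpleGraph.ConnectedComponent.mem_supp_iff, ← hmk, h1, hxk]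
  · have h1 : (G.tgt l).1 = x.1 := congrArg Prod.fst hl
    have h2 : (G.tgt l).2 = x.2 := congrArg Prod.snd hl
    refine (hext ⟨l, hli, ?_, ?_⟩).2 (Prod.ext (Subtype.ext h1) h2)
    · rw [SimpleGraph.ConnectedComponent.mem_supp_iff, hmk, h1, hxk]
    · rw [SimpleGraph.ConnectedComponent.mem_supp_iff, h1, hxk]

/-- The assignment of a component and a closed face in it is injective, because `faceMap` recovers
the original face. -/
lemma card_internalFace_le_sum [Finite V] (μ : L → ℕ) (i : ℕ) [Fintype (G.Component μ i)] :
    {f : G.InternalFace | ∀ l, G.faceOf f.1.1 (G.src l) = f.1 → i ≤ μ l}.ncard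
      ≤ ∑ k : G.Component μ i, Nat.card (G.quasiLocal μ i k).InternalFace := by
  rw [← Nat.card_sigma, ← Nat.card_coe_set_eq]
  choose k g hg using G.exists_quasiLocal_internalFace μ i
  refine Nat.card_le_card_of_injective
    (fun f => (⟨k f.1 f.2, g f.1 f.2⟩ : Σ k, (G.quasiLocal μ i k).InternalFace)) ?_
  intro f f' hff
  have h := congrArg (fun x : Σ k, (G.quasiLocal μ i k).InternalFace =>
    G.faceMap x.1.supp (highLines μ i) x.2.1) hff
  simp only [hg] at h
  exact Subtype.ext (Subtype.ext h)

lemma sum_card_supp [Fintype V] (μ : L → ℕ) (i : ℕ) [Fintype (G.Component μ i)] :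
    ∑ k : G.Component μ i, Nat.card k.supp = Nat.card V := by
  rw [← Nat.card_sigma]
  exact Nat.card_congr
    (Equiv.sigmaFiberEquiv (G.skeleton (highLines μ i)).connectedComponentMk)

lemma sum_divergenceDegree [Fintype V] (μ : L → ℕ) (i : ℕ) [Fintype (G.Component μ i)] :
    ∑ k : G.Component μ i, (G.quasiLocal μ i k).divergenceDegree
      = -((Nat.card V : ℝ) - Nat.card (G.Component μ i))
        + (1 / 2) * ((∑ k : G.Component μ i, Nat.card (G.quasiLocal μ i k).InternalFace : ℕ) : ℝ) := by
  simp only [divergenceDegree]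
  rw [Finset.sum_add_distrib, ← Finset.mul_sum, Finset.sum_neg_distrib, Finset.sum_sub_distrib,
    ← G.sum_card_supp μ i]
  push_cast
  simp

/-! ## Counting -/

lemma card_line_le (G : FeynmanGraph V L) [Fintype V] [Fintype L] : Fintype.card L ≤ 4 * Fintype.card V := by
  have := Fintype.card_le_of_injective G.src G.src_injective
  simpa [mul_comm] using this

lemma card_internalFace_le [Fintype V] : Fintype.card G.InternalFace ≤ 12 * Fintype.card V := by
  have h : Function.Surjective (fun x : Fin 3 × (V × Fin 4) => G.faceOf x.1 x.2) := fun f =>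
    let ⟨h, hh⟩ := G.exists_faceOf_eq f
    ⟨(f.1, h), hh⟩
  have h1 := Nat.card_le_card_of_surjective _ h
  have h2 := Nat.card_le_card_of_injective _ (Subtype.val_injective (p := G.IsInternalFace))
  rw [Nat.card_eq_fintype_card] at h2
  refine h2.trans (h1.trans_eq ?_)
  simp
  ring

lemma norm_combinatorialConstant_le [Fintype V] [LinearOrder V] :
    ‖G.combinatorialConstant‖ ≤ 24 ^ Fintype.card V := by
  have h1 : ‖(G.wickSign : ℂ)‖ = 1 := by simp [wickSign]
  have h2 : ∀ b : Bubble, (Nat.card b.Symmetry : ℝ) ≤ 24 := by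
    intro b
    have := Nat.card_le_card_of_injective (fun s : b.Symmetry => s.1) Subtype.val_injective
    have h3 : Nat.card (Equiv.Perm (Fin 4)) = 24 := by
      rw [Nat.card_eq_fintype_card, Fintype.card_perm]; rfl
    rw [h3] at this
    exact_mod_cast this
  rw [combinatorialConstant, norm_div, norm_mul, h1, one_mul, norm_prod]
  simp only [Complex.norm_natCast]
  have h3 : ∏ v, (Nat.card (G.kind v).Symmetry : ℝ) ≤ 24 ^ Fintype.card V := by
    exact prod_le_pow_card_of_nonneg (fun _ => by positivity) fun v => h2 _
  -- With cardinality `0` the quotient is `0` by convention, so finiteness of the automorphism group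
  -- is not needed.
  rcases Nat.eq_zero_or_pos (Nat.card G.Automorphism) with h | h
  · rw [h]; simp
  · exact (div_le_self (by positivity) (by exact_mod_cast h)).trans h3

lemma norm_prod_coupling_le [Fintype V] (lamPlus lamMelon : ℂ) :
    ‖∏ v, -(G.kind v).coupling lamPlus lamMelon‖
      ≤ (1 + ‖lamPlus‖ + ‖lamMelon‖) ^ Fintype.card V := by
  rw [norm_prod]
  refine prod_le_pow_card_of_nonneg (fun _ => norm_nonneg _) fun v => ?_
  have := norm_nonneg lamPlus
  have := norm_nonneg lamMelon
  rw [norm_neg]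
  cases G.kind v <;> simp only [Bubble.coupling] <;> linarith

section PowerCounting

variable [Fintype V] [Fintype L]

/-! ## The exponents -/

/-- The power of `M` carried by an adapted basis of lines and by the lowest lines of the closed
faces is at most the one of the quasi-local subgraphs. -/
lemma prod_inv_mul_prod_sqrt_le {M : ℝ} (hM : 1 < M) {μ : L → ℕ} {ρ : ℕ} (hμ : ∀ l, μ l ≤ ρ)
    {B : Finset L}
    (hB : ∀ i, G.lineVector '' {l | i ≤ μ l}
      ⊆ Submodule.span ℚ (G.lineVector '' (B ∩ {l | i ≤ μ l})))
    {m : G.InternalFace → L}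
    (hm : ∀ f l, G.faceOf f.1.1 (G.src l) = f.1 → μ (m f) ≤ μ l) :
    (∏ l ∈ B, (M ^ μ l)⁻¹) * ∏ f, Real.sqrt (M ^ μ (m f))
      ≤ ∏ i ∈ Finset.Icc 1 ρ, ∏ᶠ k : G.Component μ i, M ^ (G.quasiLocal μ i k).divergenceDegree := by
  classical
  have hM0 : 0 < M := by linarith
  have := fun i => Fintype.ofFinite (G.Component μ i)
  have hr : ∀ i, ∏ᶠ k : G.Component μ i, M ^ (G.quasiLocal μ i k).divergenceDegree
      = M ^ ∑ k : G.Component μ i, (G.quasiLocal μ i k).divergenceDegree := fun i => by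
    rw [finprod_eq_prod_of_fintype, Real.rpow_sum_of_pos hM0]
  have h1 : ∏ l ∈ B, (M ^ μ l)⁻¹ = M ^ (-(∑ l ∈ B, μ l : ℕ) : ℝ) := by
    rw [Finset.prod_inv_distrib, Finset.prod_pow_eq_pow_sum, Real.rpow_neg hM0.le,
      Real.rpow_natCast]
  have h2 : ∏ f, Real.sqrt (M ^ μ (m f)) = M ^ ((1 / 2) * (∑ f, μ (m f) : ℕ) : ℝ) := by
    push_cast
    rw [Finset.mul_sum, Real.rpow_sum_of_pos hM0]
    refine Finset.prod_congr rfl fun f _ => ?_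
    rw [Real.sqrt_eq_rpow, ← Real.rpow_natCast, ← Real.rpow_mul hM0.le, mul_comm]
  simp only [hr]
  rw [← Real.rpow_sum_of_pos hM0, h1, h2, ← Real.rpow_add hM0]
  apply Real.rpow_le_rpow_of_exponent_le hM.le
  rw [sum_eq_sum_card_filter_le B μ hμ,
    sum_eq_sum_card_filter_le Finset.univ (fun f => μ (m f)) (fun f => hμ _)]
  push_cast
  rw [← Finset.sum_neg_distrib, Finset.mul_sum, ← Finset.sum_add_distrib]
  -- The exponents are compared scale by scale: the rank bound `h3` controls the forest, `h5` the
  -- faces.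
  refine Finset.sum_le_sum fun i _ => ?_
  rw [G.sum_divergenceDegree μ i]
  have h3 := G.card_le_ncard_add_card_component (hB i)
  have h4 : ((B : Set L) ∩ {l | i ≤ μ l}).ncard = (B.filter fun l => i ≤ μ l).card := by
    rw [← Set.ncard_coe_finset, Finset.coe_filter]
    rfl
  -- As `m f` is a lowest line of `f`, `i ≤ μ (m f)` forces every line of `f` to have scale at least
  -- `i`.
  have h5 : (Finset.univ.filter fun f => i ≤ μ (m f)).card
      ≤ ∑ k : G.Component μ i, Nat.card (G.quasiLocal μ i k).InternalFace := by
    refine le_trans ?_ (G.card_internalFace_le_sum μ i)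
    rw [← Set.ncard_coe_finset]
    refine Set.ncard_le_ncard (fun f hf l hl => ?_) (Set.toFinite _)
    simp only [Finset.coe_filter, Finset.mem_univ, true_and, Set.mem_ofPred_eq] at hf
    exact hf.trans (hm f l hl)
  rw [h4] at h3
  have h3' : (Nat.card V : ℝ) ≤ (B.filter fun l => i ≤ μ l).card + Nat.card (G.Component μ i) := by
    exact_mod_cast h3
  have h5' : ((Finset.univ.filter fun f => i ≤ μ (m f)).card : ℝ)
      ≤ ((∑ k : G.Component μ i, Nat.card (G.quasiLocal μ i k).InternalFace : ℕ) : ℝ) := by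
    exact_mod_cast h5
  linarith

/-! ## The bound on the integrand -/

open Classical in
/-- The indicator function of frequency conservation times the decay in the frequencies. -/
def frequencyBound (M T : ℝ) (μ : L → ℕ) (w : G.ExternalLeg → ℤ) (n : L → ℤ) : ℝ :=
  if ∀ v, ∑ a : Fin 4, G.halfEdgeMode w n (v, a) = 0 then
    ∏ l, Real.exp (-((Real.pi * T * (oddMode (n l) : ℝ)) ^ 2 / (2 * (M ^ μ l) ^ 2))) else 0

/-- The frequency indices form a countable set, so measurability in the momenta at fixed frequencies
suffices. -/
lemma measurable_integrand (M T : ℝ) (μ : L → ℕ) (w : G.ExternalLeg → ℤ)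
    (q : G.ExternalFace → ℝ) : Measurable (G.integrand M T μ w q) := by
  refine measurable_from_prod_countable_right fun n => ?_
  have h : ∀ l, Measurable fun p : G.InternalFace → ℝ =>
      sliceCovariance M (μ l) (G.spinAt (G.src l)) (G.spinAt (G.tgt l))
        (Real.pi * T * (oddMode (n l) : ℝ)) (G.lineMomentum q p l) := fun l => by
    refine (continuous_sliceCovariance _ _ _ _ _).measurable.comp
      (measurable_pi_lambda _ fun c => ?_)
    unfold lineMomentum faceMomentum
    split_ifs
    · exact measurable_pi_apply _
    · exact measurable_const
  have h' : Measurable fun p : G.InternalFace → ℝ => ∏ l, ((T : ℂ) *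
      sliceCovariance M (μ l) (G.spinAt (G.src l)) (G.spinAt (G.tgt l))
        (Real.pi * T * (oddMode (n l) : ℝ)) (G.lineMomentum q p l)) :=
    Finset.measurable_fun_prod _ fun l _ => (h l).const_mul (T : ℂ)
  exact h'.const_mul (∏ v : V, if ∑ a : Fin 4, G.halfEdgeMode w n (v, a) = 0
    then ((T : ℂ))⁻¹ else 0)

/-- The decay of the lines implies decay in the momenta of the closed faces. -/
lemma prod_exp_lineMomentum_le {M : ℝ} (hM : 1 < M) (μ : L → ℕ) (q : G.ExternalFace → ℝ)
    (p : G.InternalFace → ℝ) {m : G.InternalFace → L}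
    (hm : ∀ f : G.InternalFace, G.faceOf f.1.1 (G.src (m f)) = f.1) :
    ∏ l, ∏ c, Real.exp (-(M ^ μ l)⁻¹ * G.lineMomentum q p l c ^ 2)
      ≤ ∏ f, Real.exp (-(M ^ μ (m f))⁻¹ * p f ^ 2) := by
  classical
  have hM0 : 0 < M := by linarith
  simp only [← Real.exp_sum]
  apply Real.exp_le_exp.2
  simp only [neg_mul, Finset.sum_neg_distrib, neg_le_neg_iff]
  rw [← Fintype.sum_prod_type' (f := fun l c => (M ^ μ l)⁻¹ * G.lineMomentum q p l c ^ 2)]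
  -- A line lies on one face of each colour, so distinct faces use distinct pairs of a line and a
  -- colour; the terms of all other pairs are nonnegative and can be dropped.
  have hinj : Function.Injective fun f : G.InternalFace => (m f, f.1.1) := by
    intro f f' h
    have h1 : m f = m f' := congrArg Prod.fst h
    have h2 : f.1.1 = f'.1.1 := congrArg Prod.snd h
    apply Subtype.ext
    rw [← hm f, ← hm f', h1, h2]
  calc ∑ f, (M ^ μ (m f))⁻¹ * p f ^ 2
      = ∑ x ∈ Finset.univ.map ⟨_, hinj⟩, (M ^ μ x.1)⁻¹ * G.lineMomentum q p x.1 x.2 ^ 2 := by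
        rw [Finset.sum_map]
        refine Finset.sum_congr rfl fun f _ => ?_
        simp only [Function.Embedding.coeFn_mk, lineMomentum, hm, faceMomentum, dif_pos f.2]
    _ ≤ _ := Finset.sum_le_sum_of_subset_of_nonneg (Finset.subset_univ _)
        fun x _ _ => by positivity

/-- The bound decouples frequencies from momenta, ready for Tonelli. The factors `T⁻¹` come from the
vertex deltas, the factors `T` from the frequency measure. -/
lemma norm_integrand_le {M T : ℝ} (hM : 1 < M) (hT : 0 < T) (μ : L → ℕ) (w : G.ExternalLeg → ℤ)
    (q : G.ExternalFace → ℝ) {m : G.InternalFace → L}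
    (hm : ∀ f : G.InternalFace, G.faceOf f.1.1 (G.src (m f)) = f.1)
    (x : (L → ℤ) × (G.InternalFace → ℝ)) :
    ‖G.integrand M T μ w q x‖
      ≤ (T⁻¹ ^ Fintype.card V * ∏ l, (T * sliceConst M * (M ^ μ l)⁻¹))
        * (G.frequencyBound M T μ w x.1 * ∏ f, Real.exp (-(M ^ μ (m f))⁻¹ * x.2 f ^ 2)) := by
  have hM0 : 0 < M := by linarith
  have hK := sliceConst_nonneg hM
  rw [integrand, frequencyBound, norm_mul, norm_prod]
  by_cases hc : ∀ v, ∑ a : Fin 4, G.halfEdgeMode w x.1 (v, a) = 0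
  · have h1 : ∏ v : V, ‖(if ∑ a : Fin 4, G.halfEdgeMode w x.1 (v, a) = 0 then ((T : ℂ))⁻¹ else 0)‖
        = T⁻¹ ^ Fintype.card V := by
      simp [hc, abs_of_pos hT]
    rw [h1, if_pos hc, mul_assoc, norm_prod]
    gcongr
    calc ∏ l, ‖(T : ℂ) * sliceCovariance M (μ l) (G.spinAt (G.src l)) (G.spinAt (G.tgt l))
          (Real.pi * T * (oddMode (x.1 l) : ℝ)) (G.lineMomentum q x.2 l)‖
        ≤ ∏ l, (T * (sliceConst M * ((M ^ μ l)⁻¹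
          * Real.exp (-((Real.pi * T * (oddMode (x.1 l) : ℝ)) ^ 2 / (2 * (M ^ μ l) ^ 2)))
          * ∏ c, Real.exp (-(M ^ μ l)⁻¹ * G.lineMomentum q x.2 l c ^ 2)))) := by
          refine Finset.prod_le_prod (fun _ _ => norm_nonneg _) fun l _ => ?_
          rw [norm_mul, Complex.norm_real, Real.norm_of_nonneg hT.le]
          gcongr
          exact norm_sliceCovariance_le hM _ _ _ _ _
      _ = (∏ l, (T * sliceConst M * (M ^ μ l)⁻¹)) *
          ((∏ l, Real.exp (-((Real.pi * T * (oddMode (x.1 l) : ℝ)) ^ 2 / (2 * (M ^ μ l) ^ 2))))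
          * ∏ l, ∏ c, Real.exp (-(M ^ μ l)⁻¹ * G.lineMomentum q x.2 l c ^ 2)) := by
          rw [← Finset.prod_mul_distrib, ← Finset.prod_mul_distrib]
          exact Finset.prod_congr rfl fun l _ => by ring
      _ ≤ _ := by
          gcongr
          exact G.prod_exp_lineMomentum_le hM μ q x.2 hm
  · rw [if_neg hc]
    obtain ⟨v, hv⟩ := not_forall.1 hc
    rw [Finset.prod_eq_zero (Finset.mem_univ v) (by rw [if_neg hv, norm_zero])]
    simp

/-- The sum over the frequencies of all lines is bounded by the sums over the lines that do not
belong to a spanning forest. -/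
lemma tsum_frequencyBound_le {M T C : ℝ} (hM : 1 < M)
    (hC : ∀ s : ℝ, 1 ≤ s →
      Summable (fun n : ℤ =>
        Real.exp (-((Real.pi * T * (oddMode n : ℝ)) ^ 2 / (2 * s ^ 2)))) ∧
      ∑' n : ℤ, Real.exp (-((Real.pi * T * (oddMode n : ℝ)) ^ 2 / (2 * s ^ 2))) ≤ C * s)
    (μ : L → ℕ) (w : G.ExternalLeg → ℤ) [DecidableEq L] {B : Finset L}
    (hB : LinearIndepOn ℚ G.lineVector B) :
    ∑' n, ENNReal.ofReal (G.frequencyBound M T μ w n)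
      ≤ ENNReal.ofReal (∏ l ∈ Bᶜ, (C * M ^ μ l)) := by
  have hS : ∀ l, 1 ≤ M ^ μ l := fun l => one_le_pow₀ hM.le
  let g : L → ℤ → ℝ := fun l n =>
    Real.exp (-((Real.pi * T * (oddMode n : ℝ)) ^ 2 / (2 * (M ^ μ l) ^ 2)))
  have hg0 : ∀ l n, 0 ≤ g l n := fun l n => (Real.exp_pos _).le
  have hg1 : ∀ l n, g l n ≤ 1 := fun l n => Real.exp_le_one_iff.2 (neg_nonpos.2 (by positivity))
  let D : Set (L → ℤ) := {n | ∀ v, ∑ a : Fin 4, G.halfEdgeMode w n (v, a) = 0}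
  let ι := {l // l ∈ Bᶜ}
  -- A solution of the conservation laws is determined by its values off the forest, so the sum over
  -- solutions is dominated by a free sum over those values.
  have hres : Function.Injective fun (n : D) (l : ι) => n.1 l.1 := by
    intro n n' h
    refine Subtype.ext (G.eq_of_conservation hB n.2 n'.2 fun l hl => ?_)
    exact congrFun h ⟨l, by simpa using hl⟩
  calc ∑' n, ENNReal.ofReal (G.frequencyBound M T μ w n)
      = ∑' n : D, ENNReal.ofReal (G.frequencyBound M T μ w n) := by
        refine (tsum_subtype_eq_of_support_subset fun n hn => ?_).symm
        by_contra h
        refine hn ?_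
        have hn' : ¬ ∀ v, ∑ a : Fin 4, G.halfEdgeMode w n (v, a) = 0 := h
        simp only [frequencyBound, if_neg hn', ENNReal.ofReal_zero]
    _ ≤ ∑' n : D, ENNReal.ofReal (∏ l : ι, g l.1 (n.1 l.1)) := by
        refine ENNReal.tsum_le_tsum fun n => ENNReal.ofReal_le_ofReal ?_
        have hn : ∀ v, ∑ a : Fin 4, G.halfEdgeMode w n.1 (v, a) = 0 := n.2
        rw [frequencyBound, if_pos hn, Finset.prod_coe_sort Bᶜ fun l => g l (n.1 l),
          ← Finset.prod_mul_prod_compl B]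
        exact mul_le_of_le_one_left (Finset.prod_nonneg fun l _ => hg0 _ _)
          (Finset.prod_le_one (fun l _ => hg0 l _) fun l _ => hg1 l _)
    _ ≤ ∑' n : ι → ℤ, ENNReal.ofReal (∏ l : ι, g l.1 (n l)) :=
        ENNReal.tsum_comp_le_tsum_of_injective hres
          fun n : ι → ℤ => ENNReal.ofReal (∏ l : ι, g l.1 (n l))
    _ = ENNReal.ofReal (∏ l : ι, ∑' n, g l.1 n) :=
        tsum_pi_prod_ofReal (f := fun l : ι => g l.1) (fun l => (hC _ (hS _)).1) fun l => hg0 _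
    _ ≤ _ := by
        refine ENNReal.ofReal_le_ofReal ?_
        rw [← Finset.prod_coe_sort Bᶜ]
        exact Finset.prod_le_prod (fun l _ => tsum_nonneg (hg0 _)) fun l _ => (hC _ (hS _)).2

/-- A finite bound on the integral of the norm yields absolute convergence and the estimate of the
amplitude at once. -/
lemma lintegral_integrand_le (E : TensorSpace) {M T C D : ℝ} (hM : 1 < M) (hT : 0 < T) (hC0 : 0 < C)
    (hC : ∀ s : ℝ, 1 ≤ s →
      Summable (fun n : ℤ =>
        Real.exp (-((Real.pi * T * (oddMode n : ℝ)) ^ 2 / (2 * s ^ 2)))) ∧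
      ∑' n : ℤ, Real.exp (-((Real.pi * T * (oddMode n : ℝ)) ^ 2 / (2 * s ^ 2))) ≤ C * s)
    (hD : ∀ a : ℝ, 0 < a → a ≤ 1 →
      Integrable (fun p : ℝ => Real.exp (-a * p ^ 2)) E.momentumMeasure ∧
      ∫ p, Real.exp (-a * p ^ 2) ∂E.momentumMeasure ≤ D / Real.sqrt a)
    (μ : L → ℕ) (w : G.ExternalLeg → ℤ) (q : G.ExternalFace → ℝ) [DecidableEq L] {B : Finset L}
    (hB : LinearIndepOn ℚ G.lineVector B) {m : G.InternalFace → L}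
    (hm : ∀ f : G.InternalFace, G.faceOf f.1.1 (G.src (m f)) = f.1) :
    ∫⁻ x, ‖G.integrand M T μ w q x‖ₑ ∂(G.loopMeasure E)
      ≤ ENNReal.ofReal ((T⁻¹ ^ Fintype.card V * ∏ l, (T * sliceConst M * (M ^ μ l)⁻¹))
        * ((∏ l ∈ Bᶜ, (C * M ^ μ l)) * ∏ f, (D * Real.sqrt (M ^ μ (m f))))) := by
  have hM0 : 0 < M := by linarith
  have hK := sliceConst_nonneg hM
  set K := T⁻¹ ^ Fintype.card V * ∏ l, (T * sliceConst M * (M ^ μ l)⁻¹) with hKdef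
  have hK0 : 0 ≤ K := mul_nonneg (by positivity) (Finset.prod_nonneg fun l _ => by positivity)
  have hF0 : ∀ n, 0 ≤ G.frequencyBound M T μ w n := fun n => by
    unfold frequencyBound; split_ifs <;> positivity
  let H : (G.InternalFace → ℝ) → ℝ := fun p => ∏ f, Real.exp (-(M ^ μ (m f))⁻¹ * p f ^ 2)
  have hint : ∀ f : G.InternalFace, Integrable (fun p : ℝ => Real.exp (-(M ^ μ (m f))⁻¹ * p ^ 2))
      E.momentumMeasure ∧
      ∫ p, Real.exp (-(M ^ μ (m f))⁻¹ * p ^ 2) ∂E.momentumMeasure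
        ≤ D * Real.sqrt (M ^ μ (m f)) := fun f => by
    have h := hD (M ^ μ (m f))⁻¹ (by positivity) (inv_le_one_of_one_le₀ (one_le_pow₀ hM.le))
    rwa [Real.sqrt_inv, div_inv_eq_mul] at h
  calc ∫⁻ x, ‖G.integrand M T μ w q x‖ₑ ∂(G.loopMeasure E)
      ≤ ∫⁻ x, ENNReal.ofReal K * (ENNReal.ofReal (G.frequencyBound M T μ w x.1)
          * ENNReal.ofReal (H x.2)) ∂(G.loopMeasure E) := by
        refine lintegral_mono fun x => ?_
        rw [← ENNReal.ofReal_mul (hF0 _), ← ENNReal.ofReal_mul hK0, ← ofReal_norm]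
        exact ENNReal.ofReal_le_ofReal (G.norm_integrand_le hM hT μ w q hm x)
    _ = ENNReal.ofReal K * ((∑' n, ENNReal.ofReal (G.frequencyBound M T μ w n))
          * ENNReal.ofReal (∏ f : G.InternalFace,
            ∫ p, Real.exp (-(M ^ μ (m f))⁻¹ * p ^ 2) ∂E.momentumMeasure)) := by
        have hH : Measurable fun p => ENNReal.ofReal (H p) := by
          refine ENNReal.measurable_ofReal.comp (Continuous.measurable ?_)
          fun_prop
        have hF : Measurable fun n => ENNReal.ofReal (G.frequencyBound M T μ w n) :=
          measurable_of_countable _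
        have hFH : Measurable fun x : (L → ℤ) × (G.InternalFace → ℝ) =>
            ENNReal.ofReal (G.frequencyBound M T μ w x.1) * ENNReal.ofReal (H x.2) :=
          (hF.comp measurable_fst).mul (hH.comp measurable_snd)
        rw [lintegral_const_mul _ hFH, loopMeasure, lintegral_prod_mul hF.aemeasurable hH.aemeasurable, lintegral_count,
          lintegral_pi_prod_ofReal (fun f => (hint f).1) fun _ _ => (Real.exp_pos _).le]
    _ ≤ ENNReal.ofReal K * (ENNReal.ofReal (∏ l ∈ Bᶜ, (C * M ^ μ l))
          * ENNReal.ofReal (∏ f, (D * Real.sqrt (M ^ μ (m f))))) := by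
        gcongr
        · exact G.tsum_frequencyBound_le hM hC μ w hB
        · exact (hint _).2
    _ = _ := by
        rw [ENNReal.ofReal_mul hK0, ENNReal.ofReal_mul (Finset.prod_nonneg fun l _ => by positivity)]

/-- The constants collected from the lines and from the closed faces. -/
lemma prod_const_le {M T C D : ℝ} (hM : 1 < M) (hT : 0 < T) (hC0 : 0 < C) (hD0 : 0 < D)
    (μ : L → ℕ) [DecidableEq L] (B : Finset L) (m : G.InternalFace → L) :
    (T⁻¹ ^ Fintype.card V * ∏ l, (T * sliceConst M * (M ^ μ l)⁻¹))
        * ((∏ l ∈ Bᶜ, (C * M ^ μ l)) * ∏ f, (D * Real.sqrt (M ^ μ (m f))))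
      ≤ (T⁻¹ * (max 1 (T * sliceConst M) * max 1 C) ^ 4 * max 1 D ^ 12) ^ Fintype.card V
        * ((∏ l ∈ B, (M ^ μ l)⁻¹) * ∏ f, Real.sqrt (M ^ μ (m f))) := by
  have hM0 : 0 < M := by linarith
  have hK := sliceConst_nonneg hM
  have hl : (∏ l, (T * sliceConst M * (M ^ μ l)⁻¹)) * (∏ l ∈ Bᶜ, (C * M ^ μ l))
      ≤ (max 1 (T * sliceConst M) * max 1 C) ^ (4 * Fintype.card V) * ∏ l ∈ B, (M ^ μ l)⁻¹ := by
    rw [Finset.prod_mul_distrib (s := Finset.univ), Finset.prod_mul_distrib (s := Bᶜ),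
      ← Finset.prod_mul_prod_compl B fun l => (M ^ μ l)⁻¹]
    -- Off the forest, the gain of the slice cancels the cost of the frequency sum.
    have h1 : (∏ l ∈ Bᶜ, (M ^ μ l)⁻¹) * ∏ l ∈ Bᶜ, M ^ μ l = 1 := by
      rw [← Finset.prod_mul_distrib]
      exact Finset.prod_eq_one fun l _ => inv_mul_cancel₀ (by positivity)
    -- The maxima with `1` make the powers monotone, so that the number of factors can be raised to
    -- `4V`.
    have h2 : (∏ _l : L, (T * sliceConst M)) * ∏ _l ∈ Bᶜ, C
        ≤ (max 1 (T * sliceConst M) * max 1 C) ^ (4 * Fintype.card V) := by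
      rw [Finset.prod_const, Finset.prod_const, mul_pow (max 1 _) (max 1 C), Finset.card_univ]
      refine mul_le_mul ?_ ?_ (pow_nonneg hC0.le _)
        (pow_nonneg (zero_le_one.trans (le_max_left _ _)) _)
      · refine (pow_le_pow_left₀ (by positivity) (le_max_right 1 _) _).trans
          (pow_le_pow_right₀ (le_max_left _ _) G.card_line_le)
      · refine (pow_le_pow_left₀ hC0.le (le_max_right 1 _) _).trans
          (pow_le_pow_right₀ (le_max_left _ _) ((Finset.card_le_univ _).trans G.card_line_le))
    calc _ = ((∏ _l : L, (T * sliceConst M)) * ∏ _l ∈ Bᶜ, C) * (∏ l ∈ B, (M ^ μ l)⁻¹)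
          * ((∏ l ∈ Bᶜ, (M ^ μ l)⁻¹) * ∏ l ∈ Bᶜ, M ^ μ l) := by ring
      _ ≤ _ := by rw [h1, mul_one]; gcongr
  have hf : ∏ f : G.InternalFace, (D * Real.sqrt (M ^ μ (m f)))
      ≤ max 1 D ^ (12 * Fintype.card V) * ∏ f, Real.sqrt (M ^ μ (m f)) := by
    rw [Finset.prod_mul_distrib, Finset.prod_const, Finset.card_univ]
    gcongr
    exact (pow_le_pow_left₀ hD0.le (le_max_right 1 _) _).trans
      (pow_le_pow_right₀ (le_max_left _ _) G.card_internalFace_le)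
  calc _ = T⁻¹ ^ Fintype.card V
        * ((∏ l, (T * sliceConst M * (M ^ μ l)⁻¹)) * (∏ l ∈ Bᶜ, (C * M ^ μ l)))
        * ∏ f, (D * Real.sqrt (M ^ μ (m f))) := by ring
    _ ≤ T⁻¹ ^ Fintype.card V
        * ((max 1 (T * sliceConst M) * max 1 C) ^ (4 * Fintype.card V) * ∏ l ∈ B, (M ^ μ l)⁻¹)
        * (max 1 D ^ (12 * Fintype.card V) * ∏ f, Real.sqrt (M ^ μ (m f))) := by
        gcongr
    _ = _ := by
        rw [pow_mul, pow_mul, mul_pow (_ * _), mul_pow T⁻¹]; ring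

end PowerCounting

end FeynmanGraph

end

/-! ### Assembly of the power counting bound -/

theorem mainTheorem1 (E : TensorSpace) (M T : ℝ) (hM : 1 < M) (hT : 0 < T)
    (lamPlus lamMelon : ℂ) :
    ∃ K : ℝ, 0 < K ∧
      ∀ (V L : Type) [Fintype V] [LinearOrder V] [Fintype L] (G : FeynmanGraph V L),
        G.Connected →
        ∀ (ρ : ℕ) (μ : L → ℕ), (∀ l, μ l ≤ ρ) →
        ∀ (w : G.ExternalLeg → ℤ) (q : G.ExternalFace → ℝ),
          Integrable (G.integrand M T μ w q) (G.loopMeasure E) ∧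
          ‖G.amplitude E M T lamPlus lamMelon μ w q‖ ≤
            K ^ Fintype.card V *
              ∏ i ∈ Finset.Icc 1 ρ, ∏ᶠ k : G.Component μ i,
                M ^ (G.quasiLocal μ i k).divergenceDegree := by
  obtain ⟨C, hC0, hC⟩ := exists_tsum_matsubara_le hT
  obtain ⟨D, hD0, hD⟩ := exists_integral_momentumMeasure_le E
  -- Per vertex: `24 = 4!` bounds the symmetries, the next factor the coupling (the `1` keeps it
  -- positive), and the last one collects the constants of at most 4 lines and 12 closed faces.
  refine ⟨24 * (1 + ‖lamPlus‖ + ‖lamMelon‖)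
    * (T⁻¹ * (max 1 (T * sliceConst M) * max 1 C) ^ 4 * max 1 D ^ 12), by positivity, ?_⟩
  intro V L _ _ _ G _ ρ μ hμ w q
  classical
  obtain ⟨B', hB', hspan⟩ := exists_linearIndepOn_forall_scale (K := ℚ) G.lineVector μ hμ
  obtain ⟨B, rfl⟩ : ∃ B : Finset L, (B : Set L) = B' := ⟨B'.toFinset, by simp⟩
  choose m hm hmin using G.exists_lowest_line μ
  have hle := G.lintegral_integrand_le E hM hT hC0 hC hD μ w q hB' hm
  refine ⟨⟨(G.measurable_integrand M T μ w q).aestronglyMeasurable,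
    hle.trans_lt ENNReal.ofReal_lt_top⟩, ?_⟩
  have h1 := G.prod_const_le hM hT hC0 hD0 μ B m
  have h2 := G.prod_inv_mul_prod_sqrt_le hM hμ hspan hmin
  have hM0 : 0 < M := by linarith
  have h0 : 0 ≤ (∏ l ∈ B, (M ^ μ l)⁻¹) * ∏ f, Real.sqrt (M ^ μ (m f)) := by positivity
  have h3 : ‖∫ x, G.integrand M T μ w q x ∂(G.loopMeasure E)‖
      ≤ (T⁻¹ * (max 1 (T * sliceConst M) * max 1 C) ^ 4 * max 1 D ^ 12) ^ Fintype.card V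
        * ((∏ l ∈ B, (M ^ μ l)⁻¹) * ∏ f, Real.sqrt (M ^ μ (m f))) := by
    have h4 := (enorm_integral_le_lintegral_enorm (G.integrand M T μ w q)).trans
      (hle.trans (ENNReal.ofReal_le_ofReal h1))
    rwa [← ofReal_norm, ENNReal.ofReal_le_ofReal_iff (by positivity)] at h4
  rw [FeynmanGraph.amplitude, norm_mul, norm_mul, mul_pow, mul_pow]
  calc _ ≤ 24 ^ Fintype.card V * (1 + ‖lamPlus‖ + ‖lamMelon‖) ^ Fintype.card V
        * ((T⁻¹ * (max 1 (T * sliceConst M) * max 1 C) ^ 4 * max 1 D ^ 12) ^ Fintype.card V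
        * ((∏ l ∈ B, (M ^ μ l)⁻¹) * ∏ f, Real.sqrt (M ^ μ (m f)))) := by
        gcongr
        · exact G.norm_combinatorialConstant_le
        · exact G.norm_prod_coupling_le _ _
    _ ≤ _ := by
        rw [← mul_assoc]
        gcongr
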